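/- Let $A$ be a non-zero unital $C^*$-algebra and let $I\subseteq\mathbb{R}$ be an interval (for instance $I=[0,\infty)$). Let $P_A(I)$ denote the set of real-valued continuous functions $f$ on $I$ that are $A$-monotone, i.e. such that for all self-adjoint $x,y\in A$ with spectrum contained in $I$, $x\le y$ implies $f(x)\le f(y)$, where $f(x)$, $f(y)$ are given by the continuous functional calculus and $\le$ is the usual order of $A$ (positivity of the difference). For a positive integer $n$ let $P_n(I)=P_{M_n(\mathbb{C})}(I)$ be the set of matrix monotone functions of order $n$ on $I$. If $A$ is $n$-homogeneous, that is, if every non-zero irreducible representation of $A$ on a Hilbert space is $n$-dimensional, then $$P_A(I)=P_n(I).$$ -/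

import Mathlib

open scoped ComplexOrder

universe u

/-- `P_A(I)`: the real functions, continuous on `I`, such that `x ≤ y` implies `f(x) ≤ f(y)` for all
self-adjoint `x`, `y` in the unital C⋆-algebra `A` with spectrum in `I`. Here `f(x)` is the
continuous functional calculus; only the values of `f` on `I` matter. -/
def monotoneFunctions (A : Type*) [CStarAlgebra A] [PartialOrder A] [StarOrderedRing A]
    (I : Set ℝ) : Set (ℝ → ℝ) :=
  {f | ContinuousOn f I ∧
    ∀ x y : A, IsSelfAdjoint x → IsSelfAdjoint y → spectrum ℝ x ⊆ I → spectrum ℝ y ⊆ I →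
      x ≤ y → cfc f x ≤ cfc f y}

/-- `P_n(I)`: the matrix monotone functions of order `n` on `I`, that is `P_A(I)` for `A` the
C⋆-algebra of complex `n × n` matrices. -/
def matrixMonotoneFunctions (n : ℕ) (I : Set ℝ) : Set (ℝ → ℝ) :=
  monotoneFunctions (CStarMatrix (Fin n) (Fin n) ℂ) I

/-- A representation of `A` on the Hilbert space `H` is irreducible if the only closed invariant
subspaces are `0` and `H`. The zero representation on a space of dimension at most one is
irreducible in this sense. -/
def IsIrreducibleRep {A H : Type*} [CStarAlgebra A] [NormedAddCommGroup H]
    [InnerProductSpace ℂ H] [CompleteSpace H] (π : A →⋆ₙₐ[ℂ] (H →L[ℂ] H)) : Prop :=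
  ∀ K : Submodule ℂ H, IsClosed (K : Set H) → (∀ a : A, ∀ v ∈ K, π a v ∈ K) → K = ⊥ ∨ K = ⊤

/-- `A` is `n`-homogeneous: every non-zero irreducible representation of `A` on a Hilbert space is
`n`-dimensional. The Hilbert space of an irreducible representation is the closure of an orbit of
`A`, so up to unitary equivalence all of them live in the universe of `A`. -/
def IsHomogeneousCStar (n : ℕ) (A : Type u) [CStarAlgebra A] : Prop :=
  ∀ (H : Type u) [NormedAddCommGroup H] [InnerProductSpace ℂ H] [CompleteSpace H]
    (π : A →⋆ₙₐ[ℂ] (H →L[ℂ] H)), π ≠ 0 → IsIrreducibleRep π → Module.rank ℂ H = n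

/-! Everything rests on homomorphisms from `A` onto the `n × n` matrices. They detect positivity. If
a self-adjoint `a` is not positive, Hahn–Banach gives a state negative at `a`, and Krein–Milman an
extreme one. Its GNS representation is irreducible, hence `n`-dimensional by homogeneity, hence onto
all operators by Burnside. Since homomorphisms preserve order and commute with the functional
calculus, applying this to `f(y) - f(x)` shows that matrix monotone functions are `A`-monotone.
Conversely, one surjection suffices: after a small perturbation of the larger element, an ordered
pair of matrices lifts to an ordered pair in `A` with spectra in the same compact subinterval of `I`
(`exists_lift_pair`). Continuity of the functional calculus removes the perturbation. -/

open scoped ComplexStarModule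

/-! ### States and extreme states -/

section States

variable (A : Type*) [CStarAlgebra A] [PartialOrder A] [StarOrderedRing A]

/-- The real parts of the states of a unital C⋆-algebra, as a subset of the real weak dual. -/
def realStates : Set (WeakDual ℝ A) :=
  {g | g 1 = 1 ∧ ∀ x : A, 0 ≤ (ℜ x : A) → 0 ≤ g x}

variable {A}

/-- The elements `‖x‖ • 1 ± x` have positive real part. The bound gives compactness of the state
space and forces `g 1 > 0` when `g` is non-zero. -/
theorem abs_apply_le_mul_norm (g : A →ₗ[ℝ] ℝ) (hg : ∀ x : A, 0 ≤ (ℜ x : A) → 0 ≤ g x) (x : A) :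
    |g x| ≤ g 1 * ‖x‖ := by
  have hn : ‖(ℜ x : A)‖ ≤ ‖x‖ := realPart.norm_le x
  have hone : (ℜ (1 : A) : A) = 1 := by simp
  have hle : (ℜ x : A) ≤ algebraMap ℝ A ‖x‖ :=
    (IsSelfAdjoint.le_algebraMap_norm_self (ℜ x).2).trans (algebraMap_mono A hn)
  have hge : -algebraMap ℝ A ‖x‖ ≤ (ℜ x : A) :=
    (neg_le_neg (algebraMap_mono A hn)).trans
      (IsSelfAdjoint.neg_algebraMap_norm_le_self (ℜ x).2)
  have h1 := hg (‖x‖ • 1 - x) (by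
    simpa [hone, Algebra.algebraMap_eq_smul_one] using hle)
  have h2 := hg (‖x‖ • 1 + x) (by
    have := neg_le_iff_add_nonneg.1 hge
    simpa [hone, Algebra.algebraMap_eq_smul_one, add_comm] using this)
  simp only [map_sub, map_add, map_smul, smul_eq_mul] at h1 h2
  rw [abs_le]
  constructor <;> linarith

theorem convex_realStates {A : Type*} [CStarAlgebra A] [PartialOrder A] : Convex ℝ (realStates A) := by
  rintro f ⟨hf1, hf⟩ g ⟨hg1, hg⟩ s t hs ht hst
  refine ⟨?_, fun x hx ↦ ?_⟩
  · change s * f 1 + t * g 1 = 1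
    rw [hf1, hg1]; linarith
  · change 0 ≤ s * f x + t * g x
    have := hf x hx
    have := hg x hx
    positivity

theorem isCompact_realStates : IsCompact (realStates A) := by
  refine (WeakDual.isCompact_closedBall (𝕜 := ℝ) (E := A) 0 1).of_isClosed_subset ?_ ?_
  · have : realStates A = {g | g 1 = 1} ∩ ⋂ x : A, ⋂ _ : 0 ≤ (ℜ x : A), {g | 0 ≤ g x} := by
      ext g; simp [realStates]
    rw [this]
    refine (isClosed_eq (WeakDual.eval_continuous 1) continuous_const).inter
      (isClosed_iInter fun x ↦ isClosed_iInter fun _ ↦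
        isClosed_le continuous_const (WeakDual.eval_continuous x))
  · rintro g ⟨hg1, hg⟩
    simp only [Set.mem_preimage, mem_closedBall_zero_iff]
    refine ContinuousLinearMap.opNorm_le_bound _ zero_le_one fun x ↦ ?_
    have := abs_apply_le_mul_norm (WeakDual.toStrongDual g).toLinearMap hg x
    rw [Real.norm_eq_abs]
    refine this.trans_eq ?_
    congr 1

theorem exists_mem_realStates_neg {a : A} (ha : IsSelfAdjoint a) (h : ¬ 0 ≤ a) :
    ∃ g ∈ realStates A, g a < 0 := by
  have hre : Continuous fun x : A ↦ (ℜ x : A) := by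
    simp only [realPart_apply_coe]; fun_prop
  have hconv : Convex ℝ {x : A | 0 ≤ (ℜ x : A)} := by
    intro x hx y hy s t hs ht _
    simp only [Set.mem_ofPred_eq, map_add, map_smul, AddSubgroup.coe_add, selfAdjoint.val_smul]
      at hx hy ⊢
    exact add_nonneg (smul_nonneg hs hx) (smul_nonneg ht hy)
  have hclosed : IsClosed {x : A | 0 ≤ (ℜ x : A)} := isClosed_le continuous_const hre
  obtain ⟨g, u, hgu, hug⟩ := geometric_hahn_banach_point_closed hconv hclosed (x := a)
    (by simpa [ha.coe_realPart] using h)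
  have hu : u < 0 := by simpa using hug 0 (by simp)
  have hg : ∀ x : A, 0 ≤ (ℜ x : A) → 0 ≤ g x := by
    intro x hx
    by_contra! hneg
    -- The cone contains this positive multiple of `x`, at which `g` equals `u`, although `g > u` on
    -- the cone.
    have := hug ((u / g x) • x) (by
      simp only [Set.mem_ofPred_eq, map_smul, selfAdjoint.val_smul]
      exact smul_nonneg (div_nonneg_of_nonpos hu.le hneg.le) hx)
    simp only [map_smul, smul_eq_mul] at this
    rw [div_mul_cancel₀ _ hneg.ne] at this
    exact this.false
  have hga : g a < 0 := hgu.trans hu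
  have hg1 : 0 < g 1 := by
    have := abs_apply_le_mul_norm g.toLinearMap hg a
    have h0 : 0 < |g a| := abs_pos.2 hga.ne
    by_contra! hneg
    have h2 : g 1 * ‖a‖ ≤ 0 := mul_nonpos_of_nonpos_of_nonneg hneg (norm_nonneg a)
    exact absurd (h0.trans_le (this.trans h2)) (lt_irrefl _)
  refine ⟨StrongDual.toWeakDual ((g 1)⁻¹ • g), ⟨?_, fun x hx ↦ ?_⟩, ?_⟩
  · change (g 1)⁻¹ * g 1 = 1
    exact inv_mul_cancel₀ hg1.ne'
  · change 0 ≤ (g 1)⁻¹ * g x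
    have := hg x hx
    positivity
  · change (g 1)⁻¹ * g a < 0
    exact mul_neg_of_pos_of_neg (by positivity) hga

/-- Krein–Milman: if all extreme states were nonnegative at `a`, the closed half-space `{g | 0 ≤ g
a}` would contain every state. -/
theorem exists_mem_extremePoints_realStates_neg {a : A} (ha : IsSelfAdjoint a) (h : ¬ 0 ≤ a) :
    ∃ g ∈ (realStates A).extremePoints ℝ, g a < 0 := by
  have : LocallyConvexSpace ℝ (WeakDual ℝ A) :=
    inferInstanceAs (LocallyConvexSpace ℝ (WeakBilin (topDualPairing ℝ A)))
  by_contra! hcon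
  obtain ⟨g, hg, hga⟩ := exists_mem_realStates_neg ha h
  rw [← closure_convexHull_extremePoints isCompact_realStates convex_realStates] at hg
  have hsub : closure (convexHull ℝ ((realStates A).extremePoints ℝ)) ⊆ {g | 0 ≤ g a} := by
    refine closure_minimal (convexHull_min hcon ?_)
      (isClosed_le continuous_const (WeakDual.eval_continuous a))
    intro f hf g hg s t hs ht _
    change 0 ≤ s * f a + t * g a
    have hf' : 0 ≤ f a := hf
    have hg' : 0 ≤ g a := hg
    positivity
  exact hga.not_ge (hsub hg)

/-- The complexification of a positive real functional. -/
noncomputable def complexification (g : WeakDual ℝ A) (hg : ∀ x : A, 0 ≤ (ℜ x : A) → 0 ≤ g x) :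
    A →ₚ[ℂ] ℂ :=
  .mk₀ (Module.Dual.extendRCLike (𝕜 := ℂ) (WeakDual.toStrongDual g).toLinearMap) fun x hx ↦ by
    -- Both `i x` and `-i x` have real part zero, so `g` vanishes on them and the complexified value
    -- at `x` is real.
    have him : (ℜ (Complex.I • x) : A) = 0 := by
      rw [realPart_I_smul, (IsSelfAdjoint.of_nonneg hx).imaginaryPart]; simp
    have h1 : g (Complex.I • x) = 0 := by
      refine le_antisymm ?_ (hg _ him.ge)
      have := hg (-(Complex.I • x)) (by simp [-realPart_I_smul, him])
      rw [map_neg] at this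
      linarith
    have h2 : 0 ≤ g x := hg x (by rwa [(IsSelfAdjoint.of_nonneg hx).coe_realPart])
    rw [Module.Dual.extendRCLike_apply]
    change (0 : ℂ) ≤ (g x : ℂ) - Complex.I * (g (Complex.I • x) : ℂ)
    rw [h1]
    simpa using h2

theorem re_complexification (g : WeakDual ℝ A) (hg : ∀ x : A, 0 ≤ (ℜ x : A) → 0 ≤ g x) (x : A) :
    (complexification g hg x).re = g x := by
  change (Module.Dual.extendRCLike (𝕜 := ℂ) (WeakDual.toStrongDual g).toLinearMap x).re = g x
  rw [Module.Dual.extendRCLike_apply]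
  change ((g x : ℂ) - Complex.I * (g (Complex.I • x) : ℂ)).re = g x
  simp

end States

/-! ### GNS representations and irreducibility -/

open scoped InnerProductSpace

section PureStates

variable {A : Type*} [CStarAlgebra A] [PartialOrder A] [StarOrderedRing A]

/-- The image of the unit in the GNS space, a cyclic vector for the GNS representation. -/
noncomputable def gnsVector (φ : A →ₚ[ℂ] ℂ) : φ.GNS := (φ.toPreGNS 1 : φ.GNS)

theorem gnsStarAlgHom_gnsVector (φ : A →ₚ[ℂ] ℂ) (x : A) :
    φ.gnsStarAlgHom x (gnsVector φ) = (φ.toPreGNS x : φ.GNS) := by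
  change φ.gnsNonUnitalStarAlgHom x (φ.toPreGNS 1 : φ.GNS) = _
  rw [PositiveLinearMap.gnsNonUnitalStarAlgHom_apply_coe]
  simp

theorem inner_gnsVector (φ : A →ₚ[ℂ] ℂ) (x : A) :
    ⟪gnsVector φ, φ.gnsStarAlgHom x (gnsVector φ)⟫_ℂ = φ x := by
  rw [gnsStarAlgHom_gnsVector, gnsVector, UniformSpace.Completion.inner_coe,
    PositiveLinearMap.preGNS_inner_def]
  simp

theorem denseRange_gnsStarAlgHom_gnsVector (φ : A →ₚ[ℂ] ℂ) :
    DenseRange fun x : A ↦ φ.gnsStarAlgHom x (gnsVector φ) := by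
  simp only [gnsStarAlgHom_gnsVector]
  exact (UniformSpace.Completion.denseRange_coe (α := φ.PreGNS)).comp
    φ.toPreGNS.surjective.denseRange (UniformSpace.Completion.continuous_coe _)

theorem inner_map_star {A H : Type*} [CStarAlgebra A] [NormedAddCommGroup H] [InnerProductSpace ℂ H] [CompleteSpace H]
    (π : A →⋆ₐ[ℂ] (H →L[ℂ] H)) (x : A) (v w : H) : ⟪π (star x) v, w⟫_ℂ = ⟪v, π x w⟫_ℂ := by
  rw [map_star, ContinuousLinearMap.star_eq_adjoint, ContinuousLinearMap.adjoint_inner_left]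

/-- The orthogonal projection onto a closed invariant subspace commutes with the representation. -/
theorem starProjection_map_comm {A H : Type*} [CStarAlgebra A] [NormedAddCommGroup H]
    [InnerProductSpace ℂ H] [CompleteSpace H] (π : A →⋆ₐ[ℂ] (H →L[ℂ] H)) (K : Submodule ℂ H) [K.HasOrthogonalProjection]
    (hK : ∀ a : A, ∀ v ∈ K, π a v ∈ K) (x : A) (v : H) :
    K.starProjection (π x v) = π x (K.starProjection v) := by
  refine (Submodule.eq_starProjection_of_mem_of_inner_eq_zero
    (hK x _ (K.starProjection_apply_mem v)) fun w hw ↦ ?_)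
  rw [← map_sub, ← inner_conj_symm, ← inner_map_star, inner_conj_symm]
  exact Submodule.starProjection_inner_eq_zero v _ (hK _ w hw)

/-- The real part of the vector functional of `v` in a representation. -/
noncomputable def vectorFunctional {H : Type*} [NormedAddCommGroup H] [InnerProductSpace ℂ H]
    [CompleteSpace H] (π : A →⋆ₐ[ℂ] (H →L[ℂ] H)) (v : H) : WeakDual ℝ A :=
  StrongDual.toWeakDual <| LinearMap.mkContinuous
    { toFun := fun x ↦ (⟪v, π x v⟫_ℂ).re
      map_add' := fun x y ↦ by simp
      map_smul' := fun r x ↦ by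
        rw [← Complex.coe_smul, map_smul]
        simp } (‖v‖ * ‖v‖) fun x ↦ by
    have h1 : ‖π x‖ ≤ ‖x‖ := NonUnitalStarAlgHom.norm_apply_le π x
    calc ‖(⟪v, π x v⟫_ℂ).re‖ ≤ ‖⟪v, π x v⟫_ℂ‖ := Complex.abs_re_le_norm _
      _ ≤ ‖v‖ * ‖π x v‖ := norm_inner_le_norm _ _
      _ ≤ ‖v‖ * (‖x‖ * ‖v‖) := by
        gcongr
        exact ((π x).le_opNorm v).trans (by gcongr)
      _ = ‖v‖ * ‖v‖ * ‖x‖ := by ring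

section

variable {H : Type*} [NormedAddCommGroup H] [InnerProductSpace ℂ H] [CompleteSpace H]
  (π : A →⋆ₐ[ℂ] (H →L[ℂ] H))

theorem vectorFunctional_apply (v : H) (x : A) :
    vectorFunctional π v x = (⟪v, π x v⟫_ℂ).re := rfl

theorem vectorFunctional_one (v : H) : vectorFunctional π v 1 = ‖v‖ ^ 2 := by
  rw [vectorFunctional_apply, map_one, one_apply_eq_self, inner_self_eq_norm_sq_to_K]
  norm_cast

theorem vectorFunctional_nonneg (v : H) {x : A} (hx : 0 ≤ (ℜ x : A)) :
    0 ≤ vectorFunctional π v x := by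
  have hpos : 0 ≤ π (ℜ x : A) := map_nonneg π hx
  have h1 : 0 ≤ (⟪v, π (ℜ x : A) v⟫_ℂ).re :=
    ((ContinuousLinearMap.nonneg_iff_isPositive _).1 hpos).re_inner_nonneg_right v
  have h2 : (⟪v, π (star x) v⟫_ℂ).re = (⟪v, π x v⟫_ℂ).re := by
    rw [← inner_conj_symm, inner_map_star, Complex.conj_re]
  rw [realPart_apply_coe, ← Complex.coe_smul, map_smul, map_add] at h1
  simp only [smul_apply, add_apply, inner_smul_right,
    inner_add_right, Complex.re_ofReal_mul, Complex.add_re, h2] at h1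
  rw [vectorFunctional_apply]
  have : (2⁻¹ : ℝ) * ((⟪v, π x v⟫_ℂ).re + (⟪v, π x v⟫_ℂ).re) = (⟪v, π x v⟫_ℂ).re := by ring
  rwa [this] at h1

theorem smul_vectorFunctional_mem_realStates {v : H} (hv : v ≠ 0) :
    (‖v‖ ^ 2)⁻¹ • vectorFunctional π v ∈ realStates A := by
  have : 0 < ‖v‖ := norm_pos_iff.2 hv
  refine ⟨?_, fun x hx ↦ ?_⟩
  · change (‖v‖ ^ 2)⁻¹ * vectorFunctional π v 1 = 1
    rw [vectorFunctional_one]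
    field_simp
  · change 0 ≤ (‖v‖ ^ 2)⁻¹ * vectorFunctional π v x
    exact mul_nonneg (by positivity) (vectorFunctional_nonneg π v hx)

/-- A unit cyclic vector whose vector functional is extreme generates an irreducible
representation. -/
theorem isIrreducibleRep_of_mem_extremePoints {ξ : H} (hξ : ‖ξ‖ = 1)
    (hcyc : DenseRange fun x : A ↦ π x ξ)
    (hext : vectorFunctional π ξ ∈ (realStates A).extremePoints ℝ) :
    IsIrreducibleRep (π : A →⋆ₙₐ[ℂ] (H →L[ℂ] H)) := by
  intro K hKc hK
  replace hK : ∀ a : A, ∀ v ∈ K, π a v ∈ K := hK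
  have : CompleteSpace K := hKc.completeSpace_coe
  set p := K.starProjection ξ with hp
  have hpK : p ∈ K := K.starProjection_apply_mem ξ
  have horth : ∀ w ∈ K, ⟪ξ - p, w⟫_ℂ = 0 := fun w hw ↦
    Submodule.starProjection_inner_eq_zero ξ w hw
  -- `K` and its orthogonal complement are both invariant, so the cross terms vanish.
  have hsplit : ∀ x, ⟪ξ, π x ξ⟫_ℂ = ⟪p, π x p⟫_ℂ + ⟪ξ - p, π x (ξ - p)⟫_ℂ := by
    intro x
    have h1 : ⟪ξ - p, π x p⟫_ℂ = 0 := horth _ (hK x p hpK)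
    have h2 : ⟪p, π x (ξ - p)⟫_ℂ = 0 := by
      rw [← inner_map_star, ← inner_conj_symm, horth _ (hK _ p hpK), map_zero]
    have h3 : ξ = p + (ξ - p) := by abel
    conv_lhs => rw [h3]
    rw [map_add, inner_add_left, inner_add_right, inner_add_right, h1, h2]
    ring
  by_cases hp0 : p = 0
  · left
    have hzero : ∀ v, K.starProjection v = 0 := by
      have : (fun v ↦ K.starProjection v) = fun _ ↦ 0 :=
        hcyc.equalizer K.starProjection.continuous continuous_const (by
          funext x
          simp [starProjection_map_comm π K hK, ← hp, hp0])
      exact fun v ↦ congrFun this v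
    rw [eq_bot_iff]
    intro v hv
    have := hzero v
    rw [Submodule.starProjection_eq_self_iff.2 hv] at this
    simpa using this
  by_cases hq0 : ξ - p = 0
  · right
    have hξK : ξ ∈ K := by rw [sub_eq_zero.1 hq0]; exact hpK
    rw [eq_top_iff]
    intro v _
    have hsub : closure (Set.range fun x : A ↦ π x ξ) ⊆ K :=
      closure_minimal (by rintro _ ⟨x, rfl⟩; exact hK x ξ hξK) hKc
    exact hsub (hcyc v)
  exfalso
  have hpn : 0 < ‖p‖ := norm_pos_iff.2 hp0
  have hqn : 0 < ‖ξ - p‖ := norm_pos_iff.2 hq0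
  have hfun : ∀ x, vectorFunctional π ξ x =
      vectorFunctional π p x + vectorFunctional π (ξ - p) x := fun x ↦ by
    simp only [vectorFunctional_apply, hsplit x, Complex.add_re]
  have hsum : ‖p‖ ^ 2 + ‖ξ - p‖ ^ 2 = 1 := by
    rw [← vectorFunctional_one π, ← vectorFunctional_one π, ← hfun, vectorFunctional_one, hξ,
      one_pow]
  have hseg : vectorFunctional π ξ ∈ openSegment ℝ
      ((‖p‖ ^ 2)⁻¹ • vectorFunctional π p) ((‖ξ - p‖ ^ 2)⁻¹ • vectorFunctional π (ξ - p)) := by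
    refine ⟨‖p‖ ^ 2, ‖ξ - p‖ ^ 2, by positivity, by positivity, hsum, ?_⟩
    rw [smul_inv_smul₀ (by positivity), smul_inv_smul₀ (by positivity)]
    exact DFunLike.ext _ _ fun x ↦ (hfun x).symm
  -- The state of `ξ` is a convex combination of the normalized states of `p` and `ξ - p`;
  -- extremality identifies it with that of `p`. Density of the orbit then gives `p = ‖p‖² ξ`, so
  -- `‖p‖ = 1` and `ξ - p = 0`, a contradiction.
  have heq := hext.2 (smul_vectorFunctional_mem_realStates π hp0)
    (smul_vectorFunctional_mem_realStates π hq0) hseg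
  have hre : ∀ x, (⟪p, π x p⟫_ℂ).re = ‖p‖ ^ 2 * (⟪ξ, π x ξ⟫_ℂ).re := fun x ↦ by
    rw [← vectorFunctional_apply, ← vectorFunctional_apply, ← heq]
    change _ = ‖p‖ ^ 2 * ((‖p‖ ^ 2)⁻¹ * vectorFunctional π p x)
    rw [mul_inv_cancel_left₀ (by positivity)]
  have hrep : ∀ x, (⟪π x ξ, p - (‖p‖ ^ 2 : ℝ) • ξ⟫_ℂ).re = 0 := fun x ↦ by
    have h1 : ⟪ξ, π (star x) p⟫_ℂ = ⟪p, π (star x) p⟫_ℂ := by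
      have := horth _ (hK (star x) p hpK)
      rwa [inner_sub_left, sub_eq_zero] at this
    have h2 := hre (star x)
    rw [← star_star x, inner_map_star, map_sub, ← Complex.coe_smul, map_smul, inner_sub_right,
      inner_smul_right, Complex.sub_re, Complex.re_ofReal_mul, h1, h2, sub_self]
  have hv : ∀ v : H, (⟪v, p - (‖p‖ ^ 2 : ℝ) • ξ⟫_ℂ).re = 0 := by
    have : (fun v : H ↦ (⟪v, p - (‖p‖ ^ 2 : ℝ) • ξ⟫_ℂ).re) = fun _ ↦ 0 :=
      hcyc.equalizer (by fun_prop) continuous_const (funext hrep)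
    exact fun v ↦ congrFun this v
  have hpξ : p = (‖p‖ ^ 2 : ℝ) • ξ := by
    have := hv (p - (‖p‖ ^ 2 : ℝ) • ξ)
    exact sub_eq_zero.1 ((re_inner_self_nonpos (𝕜 := ℂ)).1 this.le)
  have hnorm : ‖p‖ = ‖p‖ ^ 2 := by
    conv_lhs => rw [hpξ]
    rw [norm_smul, hξ, mul_one, Real.norm_of_nonneg (by positivity)]
  have hp1 : ‖p‖ = 1 := by
    have : ‖p‖ * (‖p‖ - 1) = 0 := by linarith
    rcases mul_eq_zero.1 this with h | h <;> linarith
  rw [hp1] at hsum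
  have : 0 < ‖ξ - p‖ ^ 2 := by positivity
  linarith

end

end PureStates

/-- Irreducible representations detect positivity of self-adjoint elements. -/
theorem exists_isIrreducibleRep_not_nonneg {A : Type u} [CStarAlgebra A] [PartialOrder A]
    [StarOrderedRing A] {a : A} (ha : IsSelfAdjoint a) (h : ¬ 0 ≤ a) :
    ∃ (H : Type u) (_ : NormedAddCommGroup H) (_ : InnerProductSpace ℂ H) (_ : CompleteSpace H)
      (π : A →⋆ₐ[ℂ] (H →L[ℂ] H)), Nontrivial H ∧
        IsIrreducibleRep (π : A →⋆ₙₐ[ℂ] (H →L[ℂ] H)) ∧ ¬ 0 ≤ π a := by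
  obtain ⟨g, hg, hga⟩ := exists_mem_extremePoints_realStates_neg ha h
  set φ := complexification g hg.1.2 with hφ
  have hvec : vectorFunctional φ.gnsStarAlgHom (gnsVector φ) = g := DFunLike.ext _ _ fun x ↦ by
    rw [vectorFunctional_apply, inner_gnsVector, hφ, re_complexification]
  have hnorm : ‖gnsVector φ‖ = 1 := by
    have := vectorFunctional_one φ.gnsStarAlgHom (gnsVector φ)
    rw [hvec, hg.1.1] at this
    exact (pow_eq_one_iff_of_nonneg (norm_nonneg _) two_ne_zero).1 this.symm
  refine ⟨φ.GNS, inferInstance, inferInstance, inferInstance, φ.gnsStarAlgHom, ?_, ?_, ?_⟩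
  · exact ⟨gnsVector φ, 0, fun h0 ↦ by simp [h0] at hnorm⟩
  · exact isIrreducibleRep_of_mem_extremePoints _ hnorm (denseRange_gnsStarAlgHom_gnsVector φ)
      (by rwa [hvec])
  · intro hpos
    have := ((ContinuousLinearMap.nonneg_iff_isPositive _).1 hpos).re_inner_nonneg_right
      (gnsVector φ)
    rw [inner_gnsVector] at this
    exact hga.not_ge (by rwa [← re_complexification g hg.1.2 a])

/-- **Burnside's theorem** for representations: a unital irreducible representation on a
finite-dimensional Hilbert space is surjective. -/
theorem surjective_of_isIrreducibleRep {A H : Type*} [CStarAlgebra A] [NormedAddCommGroup H]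
    [InnerProductSpace ℂ H] [CompleteSpace H] [FiniteDimensional ℂ H] [Nontrivial H]
    (π : A →⋆ₐ[ℂ] (H →L[ℂ] H)) (hπ : IsIrreducibleRep (π : A →⋆ₙₐ[ℂ] (H →L[ℂ] H))) :
    Function.Surjective π := by
  let ρ : A →+* Module.End ℂ H :=
    (ContinuousLinearMap.toLinearMapRingHom (R₁ := ℂ) (M₁ := H)).comp (π : A →+* (H →L[ℂ] H))
  let : Module A H := Module.compHom H ρ
  have hsmul : ∀ (a : A) (v : H), a • v = π a v := fun _ _ ↦ rfl
  have : IsScalarTower ℂ A H := ⟨fun c a v ↦ by simp [hsmul]⟩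
  have : IsSimpleModule A H :=
    { exists_pair_ne := ⟨⊥, ⊤, bot_ne_top⟩
      eq_bot_or_eq_top := fun N ↦ by
        have := hπ (N.restrictScalars ℂ) (Submodule.closed_of_finiteDimensional _)
          (fun a v hv ↦ N.smul_mem a hv)
        simpa using this }
  intro T
  -- By Schur's lemma the commutant is the scalars, so every `T` is linear over it, and the density
  -- theorem matches `T` on a basis.
  have hbij := IsSimpleModule.algebraMap_end_bijective_of_isAlgClosed (A := A) (V := H) ℂ
  let f : Module.End (Module.End A H) H :=
    { toFun := T
      map_add' := map_add T
      map_smul' := fun e v ↦ by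
        obtain ⟨c, rfl⟩ := hbij.2 e
        simp }
  have hfin : (Set.range (Module.finBasis ℂ H)).Finite := Set.finite_range _
  obtain ⟨a, ha⟩ := jacobson_density f hfin.toFinset
  refine ⟨a, ContinuousLinearMap.coe_inj.1 <| (Module.finBasis ℂ H).ext fun i ↦ ?_⟩
  exact (ha _ (by simp)).symm

/-- Operators on an `n`-dimensional Hilbert space are complex `n × n` matrices. -/
noncomputable def operatorsEquivMatrix {H : Type*} [NormedAddCommGroup H]
    [InnerProductSpace ℂ H] [CompleteSpace H] [FiniteDimensional ℂ H] {n : ℕ}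
    (b : OrthonormalBasis (Fin n) ℂ H) :
    (H →L[ℂ] H) ≃⋆ₐ[ℂ] CStarMatrix (Fin n) (Fin n) ℂ :=
  (({ LinearMap.toContinuousLinearMap (𝕜 := ℂ) (E := H) (F' := H) with
      map_mul' := fun _ _ ↦ rfl
      map_star' := LinearMap.adjoint_toContinuousLinearMap } :
    (H →ₗ[ℂ] H) ≃⋆ₐ[ℂ] (H →L[ℂ] H)).symm.trans (LinearMap.toMatrixOrthonormal b)).trans
    CStarMatrix.ofMatrixStarAlgEquiv

/-! ### Lifting ordered pairs along surjections -/

section Lift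

variable {A B : Type*} [CStarAlgebra A] [PartialOrder A] [StarOrderedRing A]
  [CStarAlgebra B] [PartialOrder B] [StarOrderedRing B]

theorem spectrum_subset_Icc_iff {x : A} (hx : IsSelfAdjoint x) {c d : ℝ} :
    spectrum ℝ x ⊆ Set.Icc c d ↔ algebraMap ℝ A c ≤ x ∧ x ≤ algebraMap ℝ A d := by
  rw [algebraMap_le_iff_le_spectrum hx, le_algebraMap_iff_spectrum_le hx]
  exact ⟨fun h ↦ ⟨fun t ht ↦ (h ht).1, fun t ht ↦ (h ht).2⟩, fun h t ht ↦ ⟨h.1 t ht, h.2 t ht⟩⟩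

/-- Self-adjoint elements lift along surjective homomorphisms, with control of the spectrum. -/
theorem exists_lift_spectrum_subset_Icc (π : A →⋆ₐ[ℂ] B) (hπ : Function.Surjective π) {c d : ℝ}
    (hcd : c ≤ d) {y : B} (hy : IsSelfAdjoint y) (hs : spectrum ℝ y ⊆ Set.Icc c d) :
    ∃ x : A, IsSelfAdjoint x ∧ spectrum ℝ x ⊆ Set.Icc c d ∧ π x = y := by
  obtain ⟨z, hz⟩ := hπ y
  obtain ⟨w, hw, hwy⟩ : ∃ w : A, IsSelfAdjoint w ∧ π w = y := by
    refine ⟨(2⁻¹ : ℂ) • (z + star z), ?_, ?_⟩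
    · rw [isSelfAdjoint_iff]; simp [add_comm]
    · rw [map_smul, map_add, map_star, hz, hy.star_eq, ← two_smul ℂ, smul_smul]; simp
  -- Clamping to `[c, d]` corrects the spectrum of the lift and fixes `y`, whose spectrum already
  -- lies there.
  let f : ℝ → ℝ := fun t ↦ max c (min d t)
  have hf : Continuous f := by fun_prop
  refine ⟨cfc f w, cfc_predicate f w, ?_, ?_⟩
  · rw [cfc_map_spectrum f w]
    rintro _ ⟨t, -, rfl⟩
    exact ⟨le_max_left _ _, max_le hcd (min_le_left _ _)⟩
  · rw [StarAlgHom.map_cfc π f w hf.continuousOn (map_continuous π) hw (hw.map π), hwy]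
    conv_rhs => rw [← cfc_id' ℝ y]
    refine cfc_congr fun t ht ↦ ?_
    have := hs ht
    simp [f, this.1, this.2]

/-- Ordered pairs lift along surjective homomorphisms within a compact interval, if the larger
element is bounded away from the left end point. -/
theorem exists_lift_pair (π : A →⋆ₐ[ℂ] B) (hπ : Function.Surjective π) {c d : ℝ}
    (hcd : c ≤ d) {x y : B} (hy : IsSelfAdjoint y)
    (hcx : algebraMap ℝ B c ≤ x) (hxy : x ≤ y) (hyd : y ≤ algebraMap ℝ B d)
    (hunit : IsUnit (y - algebraMap ℝ B c)) :
    ∃ X Y : A, IsSelfAdjoint X ∧ IsSelfAdjoint Y ∧ spectrum ℝ X ⊆ Set.Icc c d ∧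
      spectrum ℝ Y ⊆ Set.Icc c d ∧ X ≤ Y ∧ π X = x ∧ π Y = y := by
  obtain ⟨Y, hY, hYs, hπY⟩ := exists_lift_spectrum_subset_Icc π hπ hcd hy
    ((spectrum_subset_Icc_iff hy).2 ⟨hcx.trans hxy, hyd⟩)
  obtain ⟨hYc, hYd⟩ := (spectrum_subset_Icc_iff hY).1 hYs
  have hπc : π (algebraMap ℝ A c) = algebraMap ℝ B c := by
    rw [IsScalarTower.algebraMap_apply ℝ ℂ A, IsScalarTower.algebraMap_apply ℝ ℂ B]
    exact π.toAlgHom.commutes _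
  set S := CFC.sqrt (Y - algebraMap ℝ A c) with hS
  have hSsa : star S = S := (IsSelfAdjoint.of_nonneg (CFC.sqrt_nonneg _)).star_eq
  have hSS : S * S = Y - algebraMap ℝ A c :=
    CFC.sqrt_mul_sqrt_self _ (sub_nonneg.2 hYc)
  have hπSS : π S * π S = y - algebraMap ℝ B c := by
    rw [← map_mul, hSS, map_sub, hπY, hπc]
  have hπSsa : star (π S) = π S := by rw [← map_star, hSsa]
  obtain ⟨s, hs⟩ : IsUnit (π S) := by
    rw [← hπSS] at hunit
    exact (Commute.refl (π S)).isUnit_mul_iff.1 hunit |>.1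
  have hsinv : star (↑s⁻¹ : B) = ↑s⁻¹ := by
    rw [← Units.coe_star_inv]
    congr 2
    ext
    rw [Units.coe_star, hs, hπSsa]
  -- Here `x - c = π(S) w π(S)` with `0 ≤ w ≤ 1`. For a lift `0 ≤ W ≤ 1` of `w`, the element `S W S`
  -- lies between `0` and `S² = Y - c`, and so `S W S + c` lifts `x` below `Y`.
  set w : B := ↑s⁻¹ * (x - algebraMap ℝ B c) * ↑s⁻¹ with hw
  have hw0 : 0 ≤ w := by
    have := star_left_conjugate_nonneg (sub_nonneg.2 hcx) (↑s⁻¹ : B)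
    rwa [hsinv] at this
  have hw1 : w ≤ 1 := by
    have := star_left_conjugate_le_conjugate (sub_le_sub_right hxy (algebraMap ℝ B c)) (↑s⁻¹ : B)
    rw [hsinv, ← hπSS, ← hs] at this
    simpa [hw, mul_assoc] using this
  obtain ⟨W, hW, hWs, hπW⟩ := exists_lift_spectrum_subset_Icc π hπ zero_le_one
    (IsSelfAdjoint.of_nonneg hw0)
    ((spectrum_subset_Icc_iff (IsSelfAdjoint.of_nonneg hw0)).2 (by simpa using ⟨hw0, hw1⟩))
  obtain ⟨hW0, hW1⟩ := (spectrum_subset_Icc_iff hW).1 hWs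
  rw [map_zero] at hW0
  rw [map_one] at hW1
  have hlow : 0 ≤ S * W * S := by
    have := star_left_conjugate_nonneg hW0 S
    rwa [hSsa] at this
  have hupp : S * W * S ≤ Y - algebraMap ℝ A c := by
    have := star_left_conjugate_le_conjugate hW1 S
    rwa [hSsa, mul_one, hSS] at this
  have hXY : S * W * S + algebraMap ℝ A c ≤ Y := le_sub_iff_add_le.1 hupp
  have hX : IsSelfAdjoint (S * W * S + algebraMap ℝ A c) :=
    (IsSelfAdjoint.of_nonneg hlow).add (IsSelfAdjoint.algebraMap A (IsSelfAdjoint.all c))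
  refine ⟨S * W * S + algebraMap ℝ A c, Y, hX, hY, ?_, hYs, hXY, ?_, hπY⟩
  · exact (spectrum_subset_Icc_iff hX).2 ⟨le_add_of_nonneg_left hlow, hXY.trans hYd⟩
  · rw [map_add, map_mul, map_mul, hπW, hπc, hw, ← hs]
    simp [mul_assoc]

/-- Monotone functions of a C⋆-algebra are monotone on its quotients. -/
theorem monotoneFunctions_subset_of_surjective (π : A →⋆ₐ[ℂ] B) (hπ : Function.Surjective π)
    {I : Set ℝ} (hI : I.OrdConnected) : monotoneFunctions A I ⊆ monotoneFunctions B I := by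
  rintro f ⟨hfc, hf⟩
  refine ⟨hfc, fun x y hx hy hxI hyI hxy ↦ ?_⟩
  nontriviality B
  obtain ⟨c, hc, hcx⟩ := (ContinuousFunctionalCalculus.isCompact_spectrum (R := ℝ) x).exists_isLeast
    (ContinuousFunctionalCalculus.spectrum_nonempty x hx)
  obtain ⟨d, hd, hdy⟩ := (ContinuousFunctionalCalculus.isCompact_spectrum
    (R := ℝ) y).exists_isGreatest (ContinuousFunctionalCalculus.spectrum_nonempty y hy)
  have hcx' : algebraMap ℝ B c ≤ x := (algebraMap_le_iff_le_spectrum hx).2 fun t ht ↦ hcx ht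
  have hyd' : y ≤ algebraMap ℝ B d := (le_algebraMap_iff_spectrum_le hy).2 fun t ht ↦ hdy ht
  have hcd : c ≤ d := (algebraMap_le_iff_le_spectrum hy).1 (hcx'.trans hxy) d hd
  have hsub : Set.Icc c d ⊆ I := hI.out (hxI hc) (hyI hd)
  have hfcd : ContinuousOn f (Set.Icc c d) := hfc.mono hsub
  rcases hcd.eq_or_lt with rfl | hlt
  · have h1 : x = algebraMap ℝ B c := le_antisymm (hxy.trans hyd') hcx'
    have h2 : y = algebraMap ℝ B c := le_antisymm hyd' (hcx'.trans hxy)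
    rw [h1, h2]
  -- Moving `y` towards `d` keeps it in `[c, d]` and above `x`, and makes `Z ε - c ≥ ε (d - c)`
  -- invertible, as the lifting requires.
  let Z : ℝ → B := fun ε ↦ y + ε • (algebraMap ℝ B d - y)
  have hZcont : Continuous Z := by fun_prop
  have hZ0 : Z 0 = y := by simp [Z]
  have hZsa : ∀ ε, IsSelfAdjoint (Z ε) := fun ε ↦
    hy.add ((IsSelfAdjoint.all ε).smul ((IsSelfAdjoint.algebraMap B (IsSelfAdjoint.all d)).sub hy))
  have hyZ : ∀ ε, 0 ≤ ε → y ≤ Z ε := fun ε hε ↦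
    le_add_of_nonneg_right (smul_nonneg hε (sub_nonneg.2 hyd'))
  have hZd : ∀ ε, ε ≤ 1 → Z ε ≤ algebraMap ℝ B d := fun ε hε ↦ by
    have h1 : 0 ≤ (1 - ε) • (algebraMap ℝ B d - y) :=
      smul_nonneg (sub_nonneg.2 hε) (sub_nonneg.2 hyd')
    have h2 : algebraMap ℝ B d = Z ε + (1 - ε) • (algebraMap ℝ B d - y) := by
      simp only [Z, sub_smul, one_smul]; abel
    rw [h2]
    exact le_add_of_nonneg_right h1
  have hZunit : ∀ ε, 0 < ε → ε ≤ 1 → IsUnit (Z ε - algebraMap ℝ B c) := fun ε hε hε1 ↦ by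
    have h1 : algebraMap ℝ B (ε * (d - c)) ≤ Z ε - algebraMap ℝ B c := by
      have h2 : Z ε - algebraMap ℝ B c =
          (1 - ε) • (y - algebraMap ℝ B c) + algebraMap ℝ B (ε * (d - c)) := by
        simp only [Z, Algebra.algebraMap_eq_smul_one]; module
      rw [h2]
      exact le_add_of_nonneg_left
        (smul_nonneg (sub_nonneg.2 hε1) (sub_nonneg.2 (hcx'.trans hxy)))
    exact CStarAlgebra.isUnit_of_le _ h1
      (isStrictlyPositive_algebraMap (mul_pos hε (sub_pos.2 hlt)))
  have hmono : ∀ ε, 0 < ε → ε ≤ 1 → cfc f x ≤ cfc f (Z ε) := fun ε hε hε1 ↦ by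
    obtain ⟨X, Y, hX, hY, hXs, hYs, hXY, rfl, hπY⟩ := exists_lift_pair π hπ hcd (hZsa ε) hcx'
      (hxy.trans (hyZ ε hε.le)) (hZd ε hε1) (hZunit ε hε hε1)
    have := hf X Y hX hY (hXs.trans hsub) (hYs.trans hsub) hXY
    have hle : π (cfc f X) ≤ π (cfc f Y) := OrderHomClass.mono π this
    rwa [StarAlgHom.map_cfc π f X (hfcd.mono hXs) (map_continuous π) hX (hX.map π),
      StarAlgHom.map_cfc π f Y (hfcd.mono hYs) (map_continuous π) hY (hY.map π), hπY] at hle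
  have hZs : ∀ ε, 0 ≤ ε → ε ≤ 1 → spectrum ℝ (Z ε) ⊆ Set.Icc c d := fun ε hε hε1 ↦
    (spectrum_subset_Icc_iff (hZsa ε)).2 ⟨hcx'.trans (hxy.trans (hyZ ε hε)), hZd ε hε1⟩
  have hev : ∀ᶠ ε in nhdsWithin (0 : ℝ) (Set.Ioi 0), 0 < ε ∧ ε ≤ 1 := by
    filter_upwards [Ioc_mem_nhdsGT (zero_lt_one' ℝ)] with ε hε using hε
  have htend : Filter.Tendsto (fun ε ↦ cfc f (Z ε)) (nhdsWithin 0 (Set.Ioi 0))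
      (nhds (cfc f y)) := by
    have hZt : Filter.Tendsto Z (nhdsWithin 0 (Set.Ioi 0)) (nhds y) := by
      have := hZcont.tendsto 0
      rw [hZ0] at this
      exact this.mono_left nhdsWithin_le_nhds
    refine hZt.cfc isCompact_Icc f ?_ (.of_forall hZsa) ?_ hy hfcd
    · filter_upwards [hev] with ε hε using hZs ε hε.1.le hε.2
    · simpa [hZ0] using hZs 0 le_rfl zero_le_one
  refine ge_of_tendsto htend ?_
  filter_upwards [hev] with ε hε using hmono ε hε.1 hε.2

theorem map_cfc_le_map_cfc_of_mem_monotoneFunctions (ρ : A →⋆ₐ[ℂ] B) {I : Set ℝ} {f : ℝ → ℝ}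
    (hf : f ∈ monotoneFunctions B I) {x y : A} (hx : IsSelfAdjoint x) (hy : IsSelfAdjoint y)
    (hxI : spectrum ℝ x ⊆ I) (hyI : spectrum ℝ y ⊆ I) (hxy : x ≤ y) :
    ρ (cfc f x) ≤ ρ (cfc f y) := by
  rw [StarAlgHom.map_cfc ρ f x (hf.1.mono hxI) (map_continuous ρ) hx (hx.map ρ),
    StarAlgHom.map_cfc ρ f y (hf.1.mono hyI) (map_continuous ρ) hy (hy.map ρ)]
  have hspec : ∀ z : A, spectrum ℝ (ρ z) ⊆ spectrum ℝ z := fun z ↦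
    AlgHom.spectrum_apply_subset (ρ.toAlgHom.restrictScalars ℝ) z
  exact hf.2 _ _ (hx.map ρ) (hy.map ρ) ((hspec x).trans hxI) ((hspec y).trans hyI)
    (OrderHomClass.mono ρ hxy)

end Lift

/-! ### Homogeneous algebras and the equality -/

/-- An `n`-homogeneous C⋆-algebra has enough homomorphisms onto the `n × n` matrices to detect
positivity of self-adjoint elements. -/
theorem exists_surjective_matrix_not_nonneg {A : Type u} [CStarAlgebra A] [PartialOrder A]
    [StarOrderedRing A] {n : ℕ} (hA : IsHomogeneousCStar n A) {a : A} (ha : IsSelfAdjoint a)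
    (h : ¬ 0 ≤ a) :
    ∃ ρ : A →⋆ₐ[ℂ] CStarMatrix (Fin n) (Fin n) ℂ, Function.Surjective ρ ∧ ¬ 0 ≤ ρ a := by
  obtain ⟨H, _, _, _, π, _, hirr, hneg⟩ := exists_isIrreducibleRep_not_nonneg ha h
  have hne : (π : A →⋆ₙₐ[ℂ] (H →L[ℂ] H)) ≠ 0 := fun h0 ↦ by
    have : π 1 = 0 := DFunLike.congr_fun h0 1
    exact one_ne_zero ((map_one π).symm.trans this)
  have hrank : Module.rank ℂ H = n := hA H _ hne hirr
  have : FiniteDimensional ℂ H :=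
    Module.rank_lt_aleph0_iff.1 (hrank ▸ Cardinal.natCast_lt_aleph0)
  have hfin : Module.finrank ℂ H = n := Module.finrank_eq_of_rank_eq hrank
  let e := operatorsEquivMatrix ((stdOrthonormalBasis ℂ H).reindex (finCongr hfin))
  refine ⟨(e : (H →L[ℂ] H) →⋆ₐ[ℂ] CStarMatrix (Fin n) (Fin n) ℂ).comp π, ?_, fun hpos ↦ hneg ?_⟩
  · exact e.surjective.comp (surjective_of_isIrreducibleRep π hirr)
  · have h1 : 0 ≤ e (π a) := hpos
    have h2 : 0 ≤ e.symm (e (π a)) := map_nonneg e.symm h1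
    rwa [e.symm_apply_apply] at h2

theorem corollary2p7 {A : Type u} [CStarAlgebra A] [PartialOrder A] [StarOrderedRing A]
    [Nontrivial A] (n : ℕ) (hn : 0 < n) (hA : IsHomogeneousCStar n A)
    (I : Set ℝ) (hI : I.OrdConnected) :
    monotoneFunctions A I = matrixMonotoneFunctions n I := by
  refine Set.Subset.antisymm ?_ ?_
  -- Any non-positive self-adjoint element yields a surjection onto the matrices; `-1` is one
  -- because `A` is non-zero.
  · have hneg : ¬ (0 : A) ≤ -1 := fun h ↦
      one_ne_zero (le_antisymm (neg_nonneg.1 h) (zero_le_one' A))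
    obtain ⟨ρ, hρ, -⟩ := exists_surjective_matrix_not_nonneg hA (IsSelfAdjoint.one A).neg hneg
    exact monotoneFunctions_subset_of_surjective ρ hρ hI
  · intro f hf
    refine ⟨hf.1, fun x y hx hy hxI hyI hxy ↦ ?_⟩
    by_contra hcon
    obtain ⟨ρ, -, hρ⟩ := exists_surjective_matrix_not_nonneg hA
      ((cfc_predicate f y).sub (cfc_predicate f x)) (mt sub_nonneg.1 hcon)
    refine hρ ?_
    rw [map_sub, sub_nonneg]
    exact map_cfc_le_map_cfc_of_mem_monotoneFunctions ρ hf hx hy hxI hyI hxy
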